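/- Let $A:\mathbb R\to\mathbb R$ be infinitely differentiable and such that $A$ and all its derivatives $A^{(p)}$ vanish exponentially fast towards $+\infty$ (for every $p\in\mathbb N$ there is $c>0$ with $A^{(p)}(x)=O(e^{-cx})$ as $x\to+\infty$). For $s\in\mathbb R$ let $A_s$ be the integral operator on $L^2(\mathbb R_+)$ with kernel $A_s(x,y)=A(x+y+s)$, let $K_s=A_s^2$, that is, the operator with kernel $K_s(x,y)=\int_0^\infty A(x+r+s)A(y+r+s)\,dr$, and let $A_s^{(p)}$ be the $p$-th derivative of $A_s$ in $s$, with kernel $A^{(p)}(x+y+s)$. For $p\in\mathbb N=\{0,1,2,\dots\}$ and $s$ such that $I-K_s$ is invertible on $L^2(\mathbb R_+)$, define $$q_p(s)=\langle\delta|A_s^{(p)}(I-K_s)^{-1}|\delta\rangle,\qquad u_p(s)=\langle\delta|A_s(I-K_s)^{-1}A_s^{(p)}|\delta\rangle,$$ where $\delta$ is the Dirac mass at $0$; explicitly, with $a_p(y)=A^{(p)}(y+s)$, $$q_p(s)=A^{(p)}(s)+\big\langle a_p,(I-K_s)^{-1}A_s a_0\big\rangle_{L^2(\mathbb R_+)},\qquad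 u_p(s)=\big\langle a_0,(I-K_s)^{-1}a_p\big\rangle_{L^2(\mathbb R_+)}.$$ 1. Suppose that $A$ satisfies the orthogonality relation $\int_{\mathbb R}A(x+r)A(r+y)\,dr=\delta(x-y)$ in the sense of distributions (tested against $\varphi(x)\psi(y)$ with $\varphi,\psi\in C_c^\infty(\mathbb R)$), and that $A$ extends to a holomorphic function $F$ on a strip $\{|\mathrm{Im}\,z|<\varepsilon\}$ with $|F(z)|\le Ce^{-c\,\mathrm{Re}\,z}$ for $\mathrm{Re}\,z\ge0$, for some $\varepsilon,c>0$ and some $C$. Then $I-K_s$ is invertible on $L^2(\mathbb R_+)$ for every $s\in\mathbb R$, so that $q_p$ and $u_p$ are defined on all of $\mathbb R$. 2. At every $s\in\mathbb R$ for which $I-K_s$ is invertible, and for every $p\in\mathbb N$, the functions $q_p$ and $u_p$ are differentiable at $s$ and $$q_p'(s)=q_{p+1}(s)-q_0(s)\,u_p(s),\qquad u_p'(s)=-q_0(s)\,q_p(s).$$ -/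

import Mathlib

open MeasureTheory Filter Asymptotics
open scoped ContDiff

namespace HankelHierarchy

noncomputable section

/-- Lebesgue measure on the half-line `ℝ₊ = (0, ∞)`. -/
abbrev halfLine : Measure ℝ := volume.restrict (Set.Ioi (0 : ℝ))

/-- The real Hilbert space `L²(ℝ₊)`. -/
abbrev L2 : Type := Lp ℝ 2 halfLine

/-- The bounded operator `T` on `L²(ℝ₊)` is the integral operator with kernel `k`. -/
def HasKernel (k : ℝ → ℝ → ℝ) (T : L2 →L[ℝ] L2) : Prop :=
  ∀ f : L2, ∀ᵐ x ∂halfLine,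
    Integrable (fun y => k x y * f y) halfLine ∧ T f x = ∫ y, k x y * f y ∂halfLine

theorem HasKernel.unique {k : ℝ → ℝ → ℝ} {T T' : L2 →L[ℝ] L2}
    (h : HasKernel k T) (h' : HasKernel k T') : T = T' := by
  ext1 f
  apply Lp.ext
  filter_upwards [h f, h' f] with x hx hx'
  rw [hx.2, hx'.2]

open Classical in
/-- The bounded integral operator on `L²(ℝ₊)` with kernel `k` (the zero operator if `k` is not
the kernel of a bounded operator). -/
def integralOp (k : ℝ → ℝ → ℝ) : L2 →L[ℝ] L2 :=
  if h : ∃ T, HasKernel k T then h.choose else 0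

theorem HasKernel.integralOp_eq {k : ℝ → ℝ → ℝ} {T : L2 →L[ℝ] L2} (h : HasKernel k T) :
    integralOp k = T := by
  have h' : ∃ T, HasKernel k T := ⟨T, h⟩
  rw [integralOp, dif_pos h']
  exact h'.choose_spec.unique h

open Classical in
/-- The element of `L²(ℝ₊)` given by a square-integrable function (zero for other functions). -/
def toL2 (f : ℝ → ℝ) : L2 :=
  if h : MemLp f 2 halfLine then h.toLp f else 0

/-- `f` vanishes exponentially fast towards `+∞`. -/
def ExpDecay (f : ℝ → ℝ) : Prop :=
  ∃ c : ℝ, 0 < c ∧ f =O[atTop] fun x => Real.exp (-c * x)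

/-- The operator `A_s` on `L²(ℝ₊)`, with kernel `A_s(x, y) = A(x + y + s)`. -/
def opA (A : ℝ → ℝ) (s : ℝ) : L2 →L[ℝ] L2 :=
  integralOp fun x y => A (x + y + s)

/-- For continuous, exponentially decaying `A`, the kernel `A(x + y + s)` is the kernel of a bounded
operator on `L²(ℝ₊)`, so that `integralOp` is not the default value. -/
theorem exists_hasKernel {A : ℝ → ℝ} (hc : Continuous A) (hd : ExpDecay A) (s : ℝ) :
    ∃ T, HasKernel (fun x y => A (x + y + s)) T := by
  obtain ⟨c, hc0, hO⟩ := hd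
  obtain ⟨C, hC0, hC⟩ : ∃ C, 0 ≤ C ∧ ∀ t, 0 ≤ t → |A (t + s)| ≤ C * Real.exp (-c * t) := by
    obtain ⟨C₁, hC₁⟩ := hO.bound
    obtain ⟨N, hN⟩ := eventually_atTop.1 hC₁
    have hcont : Continuous fun t => A (t + s) * Real.exp (c * t) := by fun_prop
    obtain ⟨M, hM⟩ := (isCompact_Icc (a := (0:ℝ)) (b := max 0 (N - s))).exists_bound_of_continuousOn
      hcont.continuousOn
    refine ⟨max 0 (max M (C₁ * Real.exp (-c * s))), le_max_left _ _, fun t ht => ?_⟩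
    rcases le_or_gt t (N - s) with h | h
    · have := hM t ⟨ht, h.trans (le_max_right _ _)⟩
      rw [norm_mul, Real.norm_eq_abs, Real.norm_of_nonneg (Real.exp_pos _).le] at this
      have h2 : |A (t + s)| ≤ M * Real.exp (-c * t) := by
        have := mul_le_mul_of_nonneg_right this (Real.exp_pos (-c * t)).le
        rwa [mul_assoc, ← Real.exp_add, show c * t + -c * t = 0 by ring, Real.exp_zero,
          mul_one] at this
      exact h2.trans (by gcongr; exact (le_max_left _ _).trans (le_max_right _ _))
    · have := hN (t + s) (by linarith)
      rw [Real.norm_eq_abs, Real.norm_of_nonneg (Real.exp_pos _).le,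
        show -c * (t + s) = -c * s + -c * t by ring, Real.exp_add, ← mul_assoc] at this
      exact this.trans (by gcongr; exact (le_max_right _ _).trans (le_max_right _ _))
  have hE : MemLp (fun y : ℝ => Real.exp (-c * y)) 2 halfLine := by
    rw [memLp_two_iff_integrable_sq (by fun_prop)]
    have : (fun y : ℝ => Real.exp (-c * y) ^ 2) = fun y => Real.exp (-(2 * c) * y) := by
      ext y; rw [← Real.exp_nat_mul]; congr 1; push_cast; ring
    rw [this]
    exact integrableOn_exp_mul_Ioi (by linarith) 0
  have hk : ∀ x, 0 < x → MemLp (fun y => A (x + y + s)) 2 halfLine := by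
    intro x hx
    refine hE.of_le_mul (c := C) (by fun_prop) ?_
    filter_upwards [ae_restrict_mem measurableSet_Ioi] with y hy
    have hy : 0 < y := hy
    rw [Real.norm_eq_abs, Real.norm_of_nonneg (Real.exp_pos _).le]
    refine (hC (x + y) (by positivity)).trans ?_
    exact mul_le_mul_of_nonneg_left (Real.exp_le_exp.2 (by nlinarith)) hC0
  have hint : ∀ x, 0 < x → ∀ f : L2, Integrable (fun y => A (x + y + s) * f y) halfLine :=
    fun x hx f => (hk x hx).integrable_mul (Lp.memLp f)
  have hb : ∀ f : L2, ∀ x, 0 < x → ‖∫ y, A (x + y + s) * f y ∂halfLine‖ ≤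
      (C * ‖hE.toLp _‖ * ‖f‖) * ‖Real.exp (-c * x)‖ := by
    intro f x hx
    have h1 : Integrable (fun y => Real.exp (-c * y) * |f y|) halfLine :=
      hE.integrable_mul (Lp.memLp f).abs
    have h2 : ∫ y, Real.exp (-c * y) * |f y| ∂halfLine ≤ ‖hE.toLp _‖ * ‖f‖ := by
      have : ∫ y, Real.exp (-c * y) * |f y| ∂halfLine = inner ℝ (hE.toLp _) |f| := by
        rw [L2.inner_def]
        refine integral_congr_ae ?_
        filter_upwards [hE.coeFn_toLp, Lp.coeFn_abs f] with y h1 h2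
        rw [h1, h2]; simp [mul_comm]
      rw [this]
      exact (real_inner_le_norm (hE.toLp _) |f|).trans_eq (by rw [norm_abs_eq_norm])
    have h3 : ‖∫ y, A (x + y + s) * f y ∂halfLine‖ ≤
        ∫ y, (C * Real.exp (-c * x)) * (Real.exp (-c * y) * |f y|) ∂halfLine := by
      refine norm_integral_le_of_norm_le (h1.const_mul _) ?_
      filter_upwards [ae_restrict_mem measurableSet_Ioi] with y hy
      have hy : 0 < y := hy
      rw [norm_mul, Real.norm_eq_abs, Real.norm_eq_abs, ← mul_assoc]
      gcongr
      refine (hC (x + y) (by positivity)).trans (le_of_eq ?_)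
      rw [mul_add, Real.exp_add, mul_assoc]
    rw [integral_const_mul] at h3
    refine h3.trans ?_
    rw [Real.norm_of_nonneg (Real.exp_pos _).le]
    have := mul_le_mul_of_nonneg_left h2 (mul_nonneg hC0 (Real.exp_pos (-c * x)).le)
    linarith
  have hmem : ∀ f : L2, MemLp (fun x => ∫ y, A (x + y + s) * f y ∂halfLine) 2 halfLine := by
    intro f
    refine hE.of_le_mul (c := C * ‖hE.toLp _‖ * ‖f‖) ?_ ?_
    · have : StronglyMeasurable (Function.uncurry fun x y => A (x + y + s) * f y) := by
        refine StronglyMeasurable.mul ?_ ((Lp.stronglyMeasurable f).comp_measurable measurable_snd)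
        exact Continuous.stronglyMeasurable (by fun_prop)
      exact this.integral_prod_right.aestronglyMeasurable
    · filter_upwards [ae_restrict_mem measurableSet_Ioi] with x hx
      exact hb f x hx
  let L : L2 →ₗ[ℝ] L2 :=
    { toFun := fun f => (hmem f).toLp _
      map_add' := fun f g => by
        rw [← MemLp.toLp_add]
        refine MemLp.toLp_congr _ _ ?_
        filter_upwards [ae_restrict_mem measurableSet_Ioi] with x hx
        rw [Pi.add_apply, ← integral_add (hint x hx f) (hint x hx g)]
        refine integral_congr_ae ?_
        filter_upwards [Lp.coeFn_add f g] with y hy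
        rw [hy, Pi.add_apply, mul_add]
      map_smul' := fun r f => by
        rw [RingHom.id_apply, ← MemLp.toLp_const_smul]
        refine MemLp.toLp_congr _ _ ?_
        filter_upwards with x
        rw [Pi.smul_apply, smul_eq_mul, ← integral_const_mul]
        refine integral_congr_ae ?_
        filter_upwards [Lp.coeFn_smul r f] with y hy
        rw [hy, Pi.smul_apply, smul_eq_mul]; ring }
  refine ⟨L.mkContinuous (C * ‖hE.toLp _‖ * ‖hE.toLp _‖) fun f => ?_, fun f => ?_⟩
  · have : ‖L f‖ ≤ (C * ‖hE.toLp _‖ * ‖f‖) * ‖hE.toLp _‖ := by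
      refine Lp.norm_le_mul_norm_of_ae_le_mul ?_
      filter_upwards [(hmem f).coeFn_toLp, hE.coeFn_toLp, ae_restrict_mem measurableSet_Ioi]
        with x h1 h2 hx
      rw [h2]
      change ‖(hmem f).toLp _ x‖ ≤ _
      rw [h1]
      exact hb f x hx
    linarith
  · filter_upwards [(hmem f).coeFn_toLp, ae_restrict_mem measurableSet_Ioi] with x h1 hx
    exact ⟨hint x hx f, h1⟩

theorem opA_hasKernel {A : ℝ → ℝ} (hc : Continuous A) (hd : ExpDecay A) (s : ℝ) :
    HasKernel (fun x y => A (x + y + s)) (opA A s) := by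
  obtain ⟨T, hT⟩ := exists_hasKernel hc hd s
  rw [opA, hT.integralOp_eq]
  exact hT

/-- The operator `K_s = A_s²`. -/
def opK (A : ℝ → ℝ) (s : ℝ) : L2 →L[ℝ] L2 :=
  opA A s ^ 2

/-- The operator `(I - K_s)⁻¹`, meaningful whenever `I - K_s` is invertible. -/
def res (A : ℝ → ℝ) (s : ℝ) : L2 →L[ℝ] L2 :=
  Ring.inverse (1 - opK A s)

/-- `A_s^{(p)}|δ⟩`, the function `x ↦ A_s^{(p)}(x, 0) = A^{(p)}(x + s)`; by symmetry of the kernel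
it also represents `⟨δ|A_s^{(p)}`. -/
def vecA (A : ℝ → ℝ) (p : ℕ) (s : ℝ) : L2 :=
  toL2 fun x => iteratedDeriv p A (x + s)

/-- `q_p(s) = ⟨δ|A_s^{(p)} (I - K_s)⁻¹|δ⟩`. Since `(I - K_s)⁻¹ = I + (I - K_s)⁻¹ K_s` and
`K_s|δ⟩ = A_s (A_s|δ⟩)`, the ket `(I - K_s)⁻¹|δ⟩` is the sum of the point mass at `0` and of the
element `(I - K_s)⁻¹ A_s (A_s|δ⟩)` of `L²(ℝ₊)`; it is paired with the function
`⟨δ|A_s^{(p)} : y ↦ A^{(p)}(y + s)`. -/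
def q (A : ℝ → ℝ) (p : ℕ) (s : ℝ) : ℝ :=
  iteratedDeriv p A s + inner ℝ (vecA A p s) (res A s (opA A s (vecA A 0 s)))

/-- `u_p(s) = ⟨δ|A_s (I - K_s)⁻¹ A_s^{(p)}|δ⟩`. -/
def u (A : ℝ → ℝ) (p : ℕ) (s : ℝ) : ℝ :=
  inner ℝ (vecA A 0 s) (res A s (vecA A p s))

/-- The orthogonality relation `∫_ℝ A(x + r) A(r + y) dr = δ(x - y)` in the sense of
distributions, that is, tested against `φ(x) ψ(y)`. -/
def Orthogonality (A : ℝ → ℝ) : Prop :=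
  ∀ φ ψ : ℝ → ℝ, ContDiff ℝ ∞ φ → HasCompactSupport φ → ContDiff ℝ ∞ ψ → HasCompactSupport ψ →
    Integrable (fun r => (∫ x, A (x + r) * φ x) * (∫ y, A (r + y) * ψ y)) ∧
    ∫ r, (∫ x, A (x + r) * φ x) * (∫ y, A (r + y) * ψ y) = ∫ x, φ x * ψ x

/-- `A` extends to a holomorphic function on a strip around the real axis which vanishes
exponentially fast towards `+∞`, uniformly in the strip. -/
def AnalyticInStrip (A : ℝ → ℝ) : Prop :=
  ∃ (F : ℂ → ℂ) (ε c C : ℝ), 0 < ε ∧ 0 < c ∧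
    DifferentiableOn ℂ F {z | |z.im| < ε} ∧
    (∀ x : ℝ, F x = A x) ∧
    ∀ z : ℂ, |z.im| < ε → 0 ≤ z.re → ‖F z‖ ≤ C * Real.exp (-c * z.re)

end

end HankelHierarchy

namespace HankelHierarchy

noncomputable section

/-! The kernel depends on `x + y + s` only, so differentiating in `s` is the same as differentiating
in an integration variable, and integration by parts on the half-line leaves only boundary terms at
`0`. Write `T = A_s`, `T' = A_s'`, `a = a_0`, `R = (I - K_s)⁻¹`. The boundary terms give `T T' + T'
T = -|a⟩⟨a|` (`opA_opA_deriv_add`), hence `R' = -R|a⟩⟨a|R`, and `T a_{p+1} + T' a_p = -A^{(p)}(s) a`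
(`opA_vec_add`). In particular `(T a)' = -A(s) a`, so `(R T a)' = -q_0 R a`, which is the equation
for `q_p`. The equation for `u_p` needs a further algebraic computation, `hierarchy_identity`.

For invertibility, `A_s` is Hilbert–Schmidt, so by the Fredholm alternative only a nonzero `f` with
`A_s² f = f` has to be excluded. Such an `f` satisfies `‖A_s f‖ = ‖f‖`. Orthogonality makes every
`A_t` a contraction, in particular `A_{s-1}`, and `A_s f` is the part of `A_{s-1} f` on `(1, ∞)`,
translated to `(0, ∞)`. No mass is left on `(0, 1)`: the function `r ↦ ∫ A(y + r) f(y) dy` vanishes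
on `(s-1, s)`. It is real-analytic because `A` extends to a strip, so it vanishes identically,
whence `A_s f = 0` and `f = A_s² f = 0`. -/

/-! ### Exponential bounds and translates as vectors of `L²(ℝ₊)`. -/

theorem exists_exp_bound {B : ℝ → ℝ} (hc : Continuous B) (hd : ExpDecay B) (a : ℝ) :
    ∃ c C : ℝ, 0 < c ∧ 0 ≤ C ∧ ∀ t, a ≤ t → |B t| ≤ C * Real.exp (-c * t) := by
  obtain ⟨c, hc0, hO⟩ := hd
  obtain ⟨C₁, hC₁⟩ := hO.bound
  obtain ⟨N, hN⟩ := eventually_atTop.1 hC₁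
  have hcont : Continuous fun t => B t * Real.exp (c * t) := by fun_prop
  obtain ⟨M, hM⟩ := (isCompact_Icc (a := a) (b := N)).exists_bound_of_continuousOn
    hcont.continuousOn
  refine ⟨c, max 0 (max M C₁), hc0, le_max_left _ _, fun t ht => ?_⟩
  rcases le_or_gt t N with h | h
  · have := hM t ⟨ht, h⟩
    rw [norm_mul, Real.norm_eq_abs, Real.norm_of_nonneg (Real.exp_pos _).le] at this
    have h2 : |B t| ≤ M * Real.exp (-c * t) := by
      have := mul_le_mul_of_nonneg_right this (Real.exp_pos (-c * t)).le
      rwa [mul_assoc, ← Real.exp_add, show c * t + -c * t = 0 by ring, Real.exp_zero,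
        mul_one] at this
    exact h2.trans (by gcongr; exact (le_max_left _ _).trans (le_max_right _ _))
  · have := hN t h.le
    rw [Real.norm_eq_abs, Real.norm_of_nonneg (Real.exp_pos _).le] at this
    exact this.trans (by gcongr; exact (le_max_right _ _).trans (le_max_right _ _))

theorem memLp_exp {c : ℝ} (hc : 0 < c) :
    MemLp (fun y : ℝ => Real.exp (-c * y)) 2 halfLine := by
  rw [memLp_two_iff_integrable_sq (by fun_prop)]
  have : (fun y : ℝ => Real.exp (-c * y) ^ 2) = fun y => Real.exp (-(2 * c) * y) := by
    ext y; rw [← Real.exp_nat_mul]; congr 1; push_cast; ring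
  rw [this]
  exact integrableOn_exp_mul_Ioi (by linarith) 0

theorem norm_le_of_exp_bound {c : ℝ} (hc : 0 < c) {M : ℝ} {f : L2}
    (h : ∀ᵐ x ∂halfLine, |f x| ≤ M * Real.exp (-c * x)) :
    ‖f‖ ≤ M * ‖(memLp_exp hc).toLp _‖ := by
  refine Lp.norm_le_mul_norm_of_ae_le_mul ?_
  filter_upwards [h, (memLp_exp hc).coeFn_toLp] with x h1 h2
  rwa [h2, Real.norm_eq_abs, Real.norm_of_nonneg (Real.exp_pos _).le]

theorem memLp_shift {B : ℝ → ℝ} (hc : Continuous B) (hd : ExpDecay B) (s : ℝ) :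
    MemLp (fun x => B (x + s)) 2 halfLine := by
  obtain ⟨c, C, hc0, hC0, hC⟩ := exists_exp_bound hc hd s
  refine (memLp_exp hc0).of_le_mul (c := C * Real.exp (-c * s)) (by fun_prop) ?_
  filter_upwards [ae_restrict_mem measurableSet_Ioi] with x hx
  have hx : 0 < x := hx
  rw [Real.norm_eq_abs, Real.norm_of_nonneg (Real.exp_pos _).le, mul_assoc, ← Real.exp_add]
  refine (hC (x + s) (by linarith)).trans_eq ?_
  ring_nf

/-- The translate `x ↦ B (x + s)` as an element of `L²(ℝ₊)`. -/
def vec (B : ℝ → ℝ) (s : ℝ) : L2 :=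
  toL2 fun x => B (x + s)

theorem coeFn_vec {B : ℝ → ℝ} (hc : Continuous B) (hd : ExpDecay B) (s : ℝ) :
    vec B s =ᵐ[halfLine] fun x => B (x + s) := by
  rw [vec, toL2, dif_pos (memLp_shift hc hd s)]
  exact (memLp_shift hc hd s).coeFn_toLp

theorem inner_eq_integral (f g : L2) : inner ℝ f g = ∫ x, f x * g x ∂halfLine := by
  rw [L2.inner_def]
  simp [mul_comm]

theorem inner_vec {B : ℝ → ℝ} (hc : Continuous B) (hd : ExpDecay B) (s : ℝ) (f : L2) :
    inner ℝ (vec B s) f = ∫ y, B (y + s) * f y ∂halfLine := by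
  rw [inner_eq_integral]
  refine integral_congr_ae ?_
  filter_upwards [coeFn_vec hc hd s] with y hy
  rw [hy]

/-- The row of the kernel at `x` is itself a translate, with parameter `x + s`. Properties of `s ↦
vec B s` thus transfer to `opA`. -/
theorem opA_apply_ae {B : ℝ → ℝ} (hc : Continuous B) (hd : ExpDecay B) (s : ℝ) (f : L2) :
    opA B s f =ᵐ[halfLine] fun x => inner ℝ (vec B (x + s)) f := by
  filter_upwards [opA_hasKernel hc hd s f] with x hx
  rw [hx.2, inner_vec hc hd]
  congr 1; ext y; ring_nf

/-- Cauchy–Schwarz on each row `w x`, followed by the `L²` norm in `x`: a Hilbert–Schmidt type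
bound. -/
theorem opNorm_le_of_exp_bound {c : ℝ} (hc : 0 < c) {M : ℝ} (hM : 0 ≤ M) {T : L2 →L[ℝ] L2}
    {w : ℝ → L2} (hT : ∀ f, T f =ᵐ[halfLine] fun x => inner ℝ (w x) f)
    (hw : ∀ x, 0 < x → ‖w x‖ ≤ M * Real.exp (-c * x)) :
    ‖T‖ ≤ M * ‖(memLp_exp hc).toLp _‖ := by
  refine T.opNorm_le_bound (by positivity) fun f => ?_
  have : ‖T f‖ ≤ (M * ‖f‖) * ‖(memLp_exp hc).toLp _‖ := by
    refine norm_le_of_exp_bound hc ?_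
    filter_upwards [hT f, ae_restrict_mem measurableSet_Ioi] with x h1 hx
    rw [h1]
    calc |inner ℝ (w x) f| ≤ ‖w x‖ * ‖f‖ := abs_real_inner_le_norm _ _
      _ ≤ (M * Real.exp (-c * x)) * ‖f‖ := by gcongr; exact hw x hx
      _ = _ := by ring
  linarith

/-! ### Differentiability in `s` of the translates and of `A_s`. -/

/-- Smooth functions all of whose derivatives vanish exponentially fast towards `+∞`. -/
def SmoothDecay (B : ℝ → ℝ) : Prop :=
  ContDiff ℝ ∞ B ∧ ∀ p : ℕ, ExpDecay (iteratedDeriv p B)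

namespace SmoothDecay

variable {B : ℝ → ℝ}

protected theorem continuous (hB : SmoothDecay B) : Continuous B := hB.1.continuous

theorem expDecay (hB : SmoothDecay B) : ExpDecay B := by
  simpa using hB.2 0

protected theorem deriv (hB : SmoothDecay B) : SmoothDecay (deriv B) :=
  ⟨(contDiff_infty_iff_deriv.1 hB.1).2, fun p => by
    rw [← iteratedDeriv_succ']; exact hB.2 (p + 1)⟩

protected theorem iteratedDeriv (hB : SmoothDecay B) (p : ℕ) : SmoothDecay (iteratedDeriv p B) := by
  induction p with
  | zero => simpa using hB
  | succ p ih => rw [iteratedDeriv_succ]; exact ih.deriv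

protected theorem hasDerivAt (hB : SmoothDecay B) (x : ℝ) : HasDerivAt B (deriv B x) x :=
  (hB.1.differentiable (by simp)).differentiableAt.hasDerivAt

theorem taylor_bound (hB : SmoothDecay B) (a : ℝ) :
    ∃ c C : ℝ, 0 < c ∧ 0 ≤ C ∧ ∀ t, a ≤ t → ∀ h, |h| ≤ 1 →
      |B (t + h) - B t - h * deriv B t| ≤ C * h ^ 2 * Real.exp (-c * t) := by
  obtain ⟨c, C, hc0, hC0, hC⟩ :=
    -- The bound on the second derivative starts at `a - 1` because `t + h` may lie up to `1` to the
    -- left of `t`; the same shift costs the factor `exp c`.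
    exists_exp_bound hB.deriv.deriv.continuous hB.deriv.deriv.expDecay (a - 1)
  refine ⟨c, C * Real.exp c, hc0, by positivity, fun t ht h hh => ?_⟩
  set M := C * Real.exp c * Real.exp (-c * t) with hM
  have hM0 : 0 ≤ M := by positivity
  have hball : ∀ x ∈ Metric.closedBall t |h|, |x - t| ≤ |h| := fun x hx => by
    simpa [Real.dist_eq] using hx
  have hth : t + h ∈ Metric.closedBall t |h| := by simp
  have htt : t ∈ Metric.closedBall t |h| := by simp
  have h2 : ∀ x ∈ Metric.closedBall t |h|, ‖deriv (deriv B) x‖ ≤ M := by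
    intro x hx
    have := abs_le.1 ((hball x hx).trans hh)
    refine (hC x (by linarith)).trans ?_
    rw [hM, mul_assoc, ← Real.exp_add]
    gcongr
    nlinarith
  have h1 : ∀ x ∈ Metric.closedBall t |h|, ‖deriv B x - deriv B t‖ ≤ M * |h| := by
    intro x hx
    refine ((convex_closedBall t |h|).norm_image_sub_le_of_norm_hasDerivWithin_le
      (fun y _ => (hB.deriv.hasDerivAt y).hasDerivWithinAt) h2 htt hx).trans ?_
    gcongr
    exact hball x hx
  have h0 := (convex_closedBall t |h|).norm_image_sub_le_of_norm_hasDerivWithin_le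
      (f := fun y => B y - y * deriv B t)
      (fun y _ => ((hB.hasDerivAt y).sub
        ((hasDerivAt_id y).mul_const (deriv B t))).hasDerivWithinAt)
      (by simpa using h1) htt hth
  rw [Real.norm_eq_abs, Real.norm_eq_abs] at h0
  calc |B (t + h) - B t - h * deriv B t|
      = |B (t + h) - (t + h) * deriv B t - (B t - t * deriv B t)| := by ring_nf
    _ ≤ M * |h| * |t + h - t| := h0
    _ = C * Real.exp c * h ^ 2 * Real.exp (-c * t) := by
        rw [add_sub_cancel_left, mul_assoc, abs_mul_abs_self]; ring

/-- The decay of the remainder in `x` is what makes the rows of the operator remainder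
square-integrable. The case `x = 0` alone gives the derivative of `vec B`. -/
theorem norm_vec_taylor (hB : SmoothDecay B) (s : ℝ) :
    ∃ c C : ℝ, 0 < c ∧ 0 ≤ C ∧ ∀ x, 0 ≤ x → ∀ h, |h| ≤ 1 →
      ‖vec B (x + s + h) - vec B (x + s) - h • vec (deriv B) (x + s)‖
        ≤ C * h ^ 2 * Real.exp (-c * x) := by
  obtain ⟨c, C, hc0, hC0, hC⟩ := hB.taylor_bound s
  refine ⟨c, C * Real.exp (-c * s) * ‖(memLp_exp hc0).toLp _‖, hc0, by positivity,
    fun x hx h hh => ?_⟩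
  refine (norm_le_of_exp_bound hc0
    (M := C * h ^ 2 * Real.exp (-c * (x + s))) ?_).trans_eq ?_
  · filter_upwards [Lp.coeFn_sub (vec B (x + s + h) - vec B (x + s))
      (h • vec (deriv B) (x + s)), Lp.coeFn_sub (vec B (x + s + h)) (vec B (x + s)),
      Lp.coeFn_smul h (vec (deriv B) (x + s)),
      coeFn_vec hB.continuous hB.expDecay (x + s + h),
      coeFn_vec hB.continuous hB.expDecay (x + s),
      coeFn_vec hB.deriv.continuous hB.deriv.expDecay (x + s),
      ae_restrict_mem measurableSet_Ioi] with y e1 e2 e3 e4 e5 e6 hy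
    have hy : 0 < y := hy
    rw [e1, Pi.sub_apply, e2, Pi.sub_apply, e3, Pi.smul_apply, e4, e5, e6, smul_eq_mul]
    have := hC (y + (x + s)) (by linarith) h hh
    rw [show y + (x + s) + h = y + (x + s + h) by ring,
      show -c * (y + (x + s)) = -c * (x + s) + -c * y by ring, Real.exp_add, ← mul_assoc] at this
    exact this
  · rw [mul_add, Real.exp_add]; ring

end SmoothDecay

theorem hasDerivAt_of_norm_le_sq {E : Type*} [NormedAddCommGroup E] [NormedSpace ℝ E]
    {f : ℝ → E} {f' : E} {s C : ℝ}
    (h : ∀ t, |t| ≤ 1 → ‖f (s + t) - f s - t • f'‖ ≤ C * t ^ 2) : HasDerivAt f f' s := by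
  rw [hasDerivAt_iff_isLittleO_nhds_zero]
  have h1 : (fun t => f (s + t) - f s - t • f') =O[nhds 0] fun t : ℝ => t ^ 2 := by
    refine IsBigO.of_bound C ?_
    filter_upwards [Metric.closedBall_mem_nhds (0 : ℝ) one_pos] with t ht
    rw [Real.norm_of_nonneg (sq_nonneg t)]
    exact h t (by simpa using ht)
  refine h1.trans_isLittleO ?_
  simpa using isLittleO_pow_pow (𝕜 := ℝ) (m := 1) (n := 2) one_lt_two

namespace SmoothDecay

variable {B : ℝ → ℝ}

theorem hasDerivAt_vec (hB : SmoothDecay B) (s : ℝ) :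
    HasDerivAt (vec B) (vec (deriv B) s) s := by
  obtain ⟨c, C, -, -, h⟩ := hB.norm_vec_taylor s
  refine hasDerivAt_of_norm_le_sq (C := C) fun t ht => ?_
  simpa using h 0 le_rfl t ht

theorem hasDerivAt_opA (hB : SmoothDecay B) (s : ℝ) :
    HasDerivAt (opA B) (opA (deriv B) s) s := by
  obtain ⟨c, C, hc, hC, h⟩ := hB.norm_vec_taylor s
  refine hasDerivAt_of_norm_le_sq (C := C * ‖(memLp_exp hc).toLp _‖) fun t ht => ?_
  refine (opNorm_le_of_exp_bound hc (M := C * t ^ 2) (by positivity)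
    (w := fun x => vec B (x + s + t) - vec B (x + s) - t • vec (deriv B) (x + s))
    (fun f => ?_) (fun x hx => h x hx.le t ht)).trans_eq (by ring)
  have e : (opA B (s + t) - opA B s - t • opA (deriv B) s) f
      = opA B (s + t) f - opA B s f - t • opA (deriv B) s f := rfl
  rw [e]
  filter_upwards [Lp.coeFn_sub (opA B (s + t) f - opA B s f) (t • opA (deriv B) s f),
    Lp.coeFn_sub (opA B (s + t) f) (opA B s f),
    Lp.coeFn_smul t (opA (deriv B) s f),
    opA_apply_ae hB.continuous hB.expDecay (s + t) f,
    opA_apply_ae hB.continuous hB.expDecay s f,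
    opA_apply_ae hB.deriv.continuous hB.deriv.expDecay s f] with x e1 e2 e3 e4 e5 e6
  rw [e1, Pi.sub_apply, e2, Pi.sub_apply, e3, Pi.smul_apply, e4, e5, e6, inner_sub_left,
    inner_sub_left, real_inner_smul_left, smul_eq_mul, ← add_assoc]

end SmoothDecay

/-! ### Integration by parts on the half-line, and symmetry of `A_s`. -/

theorem integral_mul_deriv_add_deriv_mul {f f' g g' : ℝ → ℝ}
    (hf : ∀ x, HasDerivAt f (f' x) x) (hg : ∀ x, HasDerivAt g (g' x) x)
    (mf : MemLp f 2 halfLine) (mf' : MemLp f' 2 halfLine)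
    (mg : MemLp g 2 halfLine) (mg' : MemLp g' 2 halfLine) :
    ∫ x, f x * g' x ∂halfLine + ∫ x, f' x * g x ∂halfLine = -(f 0 * g 0) := by
  have i1 : Integrable (fun x => f x * g' x) halfLine := mf.integrable_mul mg'
  have i2 : Integrable (fun x => f' x * g x) halfLine := mf'.integrable_mul mg
  have i0 : Integrable (fun x => f x * g x) halfLine := mf.integrable_mul mg
  have hd : ∀ x, HasDerivAt (fun x => f x * g x) (f x * g' x + f' x * g x) x := fun x =>
    ((hf x).mul (hg x)).congr_deriv (by ring)
  rw [← integral_add i1 i2,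
    integral_Ioi_of_hasDerivAt_of_tendsto' (fun x _ => hd x) (i1.add i2)
      (tendsto_zero_of_hasDerivAt_of_integrableOn_Ioi (a := 0) (fun x _ => hd x) (i1.add i2) i0)]
  simp

namespace SmoothDecay

variable {B D : ℝ → ℝ}

protected theorem memLp_shift (hB : SmoothDecay B) (s : ℝ) : MemLp (fun x => B (x + s)) 2 halfLine :=
  HankelHierarchy.memLp_shift hB.continuous hB.expDecay s

theorem inner_vec_add (hB : SmoothDecay B) (hD : SmoothDecay D) (t s : ℝ) :
    inner ℝ (vec B t) (vec (deriv D) s) + inner ℝ (vec (deriv B) t) (vec D s)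
      = -(B t * D s) := by
  have key := integral_mul_deriv_add_deriv_mul
    (fun x => (hB.hasDerivAt (x + t)).comp_add_const x t)
    (fun x => (hD.hasDerivAt (x + s)).comp_add_const x s)
    (hB.memLp_shift t) (hB.deriv.memLp_shift t) (hD.memLp_shift s) (hD.deriv.memLp_shift s)
  simp only [zero_add] at key
  rw [← key, inner_vec hB.continuous hB.expDecay,
    inner_vec hB.deriv.continuous hB.deriv.expDecay]
  congr 1 <;> refine integral_congr_ae ?_
  · filter_upwards [coeFn_vec hD.deriv.continuous hD.deriv.expDecay s] with y hy
    rw [hy]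
  · filter_upwards [coeFn_vec hD.continuous hD.expDecay s] with y hy
    rw [hy]

theorem hasDerivAt_inner_vec (hB : SmoothDecay B) (s : ℝ) (f : L2) (x : ℝ) :
    HasDerivAt (fun x => inner ℝ (vec B (x + s)) f)
      (inner ℝ (vec (deriv B) (x + s)) f) x := by
  simpa using ((hB.hasDerivAt_vec (x + s)).comp_add_const x s).inner ℝ (hasDerivAt_const x f)

theorem opA_apply (hB : SmoothDecay B) (s : ℝ) (f : L2) :
    opA B s f =ᵐ[halfLine] fun x => inner ℝ (vec B (x + s)) f :=
  opA_apply_ae hB.continuous hB.expDecay s f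

theorem memLp_inner_vec (hB : SmoothDecay B) (s : ℝ) (f : L2) :
    MemLp (fun x => inner ℝ (vec B (x + s)) f) 2 halfLine :=
  (Lp.memLp (opA B s f)).ae_eq (hB.opA_apply s f)

theorem inner_opA_opA (hB : SmoothDecay B) (hD : SmoothDecay D) (s : ℝ) (f g : L2) :
    inner ℝ (opA B s f) (opA D s g)
      = ∫ x, inner ℝ (vec B (x + s)) f * inner ℝ (vec D (x + s)) g ∂halfLine := by
  rw [inner_eq_integral]
  refine integral_congr_ae ?_
  filter_upwards [hB.opA_apply s f, hD.opA_apply s g] with x h1 h2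
  rw [h1, h2]

/-- Integration by parts for the functions `x ↦ ⟨vec B (x + s), f⟩` and `x ↦ ⟨vec B (x + s), g⟩`,
whose `x`-derivatives represent `opA (deriv B) s f` and `opA (deriv B) s g`; the boundary term at
`0` is a rank-one form. -/
theorem inner_opA_add (hB : SmoothDecay B) (s : ℝ) (f g : L2) :
    inner ℝ (opA B s f) (opA (deriv B) s g) + inner ℝ (opA (deriv B) s f) (opA B s g)
      = -(inner ℝ (vec B s) f * inner ℝ (vec B s) g) := by
  rw [hB.inner_opA_opA hB.deriv, hB.deriv.inner_opA_opA hB,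
    integral_mul_deriv_add_deriv_mul (hB.hasDerivAt_inner_vec s f) (hB.hasDerivAt_inner_vec s g)
    (hB.memLp_inner_vec s f) (hB.deriv.memLp_inner_vec s f)
    (hB.memLp_inner_vec s g) (hB.deriv.memLp_inner_vec s g)]
  simp

theorem opA_vec_add (hB : SmoothDecay B) (hD : SmoothDecay D) (s : ℝ) :
    opA B s (vec (deriv D) s) + opA (deriv B) s (vec D s) = -(D s • vec B s) := by
  apply Lp.ext
  filter_upwards [Lp.coeFn_add (opA B s (vec (deriv D) s))
    (opA (deriv B) s (vec D s)), hB.opA_apply s (vec (deriv D) s),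
    hB.deriv.opA_apply s (vec D s), Lp.coeFn_neg (D s • vec B s), Lp.coeFn_smul (D s) (vec B s),
    coeFn_vec hB.continuous hB.expDecay s] with x e1 e2 e3 e4 e5 e6
  rw [e1, Pi.add_apply, e2, e3, e4, Pi.neg_apply, e5, Pi.smul_apply, e6, hB.inner_vec_add hD,
    smul_eq_mul, mul_comm]

/-- Fubini for a symmetric kernel; the exponential bound factorises into a product majorant in `x`
and `y`. -/
theorem inner_opA_comm (hB : SmoothDecay B) (s : ℝ) (f g : L2) :
    inner ℝ (opA B s f) g = inner ℝ f (opA B s g) := by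
  obtain ⟨c, C, hc0, hC0, hC⟩ := exists_exp_bound hB.continuous hB.expDecay s
  have hint : Integrable (Function.uncurry fun x y => B (x + y + s) * f y * g x)
      (halfLine.prod halfLine) := by
    have i1 : Integrable (fun y => Real.exp (-c * y) * f y) halfLine :=
      (memLp_exp hc0).integrable_mul (Lp.memLp f)
    have i2 : Integrable (fun y => Real.exp (-c * y) * g y) halfLine :=
      (memLp_exp hc0).integrable_mul (Lp.memLp g)
    refine ((i2.mul_prod i1).const_mul (C * Real.exp (-c * s))).mono ?_ ?_
    · refine StronglyMeasurable.aestronglyMeasurable ?_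
      refine StronglyMeasurable.mul (StronglyMeasurable.mul ?_
        ((Lp.stronglyMeasurable f).comp_measurable measurable_snd))
        ((Lp.stronglyMeasurable g).comp_measurable measurable_fst)
      have := hB.continuous
      exact Continuous.stronglyMeasurable (by fun_prop)
    · have hpos : ∀ᵐ z ∂halfLine.prod halfLine, z ∈ Set.Ioi (0 : ℝ) ×ˢ Set.Ioi (0 : ℝ) := by
        rw [Measure.prod_restrict]
        exact ae_restrict_mem (measurableSet_Ioi.prod measurableSet_Ioi)
      filter_upwards [hpos] with z hz
      have hx : 0 < z.1 := hz.1
      have hy : 0 < z.2 := hz.2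
      have hb := hC (z.1 + z.2 + s) (by linarith)
      simp only [Function.uncurry, norm_mul, Real.norm_eq_abs, Real.abs_exp, abs_of_nonneg hC0]
      calc |B (z.1 + z.2 + s)| * |f z.2| * |g z.1|
          ≤ C * Real.exp (-c * (z.1 + z.2 + s)) * |f z.2| * |g z.1| := by gcongr
        _ = _ := by
          rw [show -c * (z.1 + z.2 + s) = -c * s + -c * z.1 + -c * z.2 by ring, Real.exp_add,
            Real.exp_add]
          ring
  have h1 : inner ℝ (opA B s f) g = ∫ x, ∫ y, B (x + y + s) * f y * g x ∂halfLine ∂halfLine := by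
    rw [inner_eq_integral]
    refine integral_congr_ae ?_
    filter_upwards [opA_hasKernel hB.continuous hB.expDecay s f] with x hx
    rw [hx.2, integral_mul_const]
  have h2 : inner ℝ f (opA B s g) = ∫ y, ∫ x, B (x + y + s) * f y * g x ∂halfLine ∂halfLine := by
    rw [inner_eq_integral]
    refine integral_congr_ae ?_
    filter_upwards [opA_hasKernel hB.continuous hB.expDecay s g] with y hy
    rw [hy.2, ← integral_const_mul]
    refine integral_congr_ae (Eventually.of_forall fun x => ?_)
    simp only [add_comm y x]
    ring
  rw [h1, h2, integral_integral_swap hint]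

end SmoothDecay

/-! ### The differential hierarchy. -/

/-- The left side is `u_p'` and the right side is `-q_0 q_p`, for `a = a_0`, `v = a_p`, `α = A(s)`,
`β = A^{(p)}(s)`. The number `⟨a, w⟩` with `w = v' + T' T R v` is evaluated twice: by solving `(I -
T²) w = v' - ⟨a, R v⟩ a + κ T a` with `κ = q_p`, and by moving `T'` onto `a`. -/
theorem hierarchy_identity {H : Type*} [NormedAddCommGroup H] [InnerProductSpace ℝ H]
    {T T' R : H →L[ℝ] H} {a a' v v' : H} {α β : ℝ}
    (hT : ∀ f g, inner ℝ (T f) g = inner ℝ f (T g))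
    (hT' : ∀ f g, inner ℝ (T' f) g = inner ℝ f (T' g))
    (hR : ∀ f g, inner ℝ (R f) g = inner ℝ f (R g))
    (hR₁ : ∀ f, R f - T (T (R f)) = f) (hR₂ : ∀ f, R (f - T (T f)) = f)
    (hTT' : ∀ f, T (T' f) + T' (T f) = -(inner ℝ a f • a))
    (hv : T v' + T' v = -(β • a)) (ha : T a' + T' a = -(α • a))
    (hav : inner ℝ a v' + inner ℝ a' v = -(α * β)) :
    inner ℝ a' (R v) + inner ℝ a (R v') - inner ℝ a (R a) * inner ℝ a (R v)
      = -((α + inner ℝ a (R (T a))) * (β + inner ℝ v (R (T a)))) := by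
  set g := R v with hg
  set κ := β + inner ℝ v (R (T a)) with hκ
  have hag : inner ℝ a (T g) = inner ℝ v (R (T a)) := by
    rw [← hT, hg, ← hR, real_inner_comm]
  have e1 : T (T g) = g - v := by rw [← hR₁ v]; abel
  have e2 : T (T' (T g)) = -(inner ℝ a (T g) • a) - T' (g - v) := by
    rw [← e1, ← hTT' (T g)]; abel
  -- Commuting `T` past `T'` in both summands produces two terms `T (T' v)` that cancel; the
  -- coefficients of `T a` add up to `κ`.
  have e3 : (v' + T' (T g)) - T (T (v' + T' (T g)))
      = v' - inner ℝ a g • a + κ • T a := by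
    have e4 : T (T' g) = -(inner ℝ a g • a) - T' (T g) := by rw [← hTT' g]; abel
    have e5 : T v' = -(β • a) - T' v := by rw [← hv]; abel
    rw [map_add, map_add, e2, e5]
    simp only [map_sub, map_neg, map_smul]
    rw [e4, hag, hκ, add_smul]
    abel
  have e6 : v' + T' (T g) = R v' - inner ℝ a g • R a + κ • R (T a) := by
    rw [← hR₂ (v' + T' (T g)), e3]
    simp only [map_sub, map_add, map_smul]
  have e7 : inner ℝ a (v' + T' (T g)) = -(α * κ) - inner ℝ a' g := by
    have e8 : T' a = -(α • a) - T a' := by rw [← ha]; abel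
    have e9 : inner ℝ (T a') (T g) = inner ℝ a' g - inner ℝ a' v := by
      rw [hT, e1, inner_sub_right]
    rw [inner_add_right, ← hT', e8, inner_sub_left, inner_neg_left, real_inner_smul_left, e9,
      hag, hκ]
    linarith
  rw [e6, inner_add_right, inner_sub_right, real_inner_smul_right, real_inner_smul_right] at e7
  linarith

variable {A : ℝ → ℝ}

theorem SmoothDecay.opA_opA_deriv_add (hA : SmoothDecay A) (s : ℝ) (f : L2) :
    opA A s (opA (deriv A) s f) + opA (deriv A) s (opA A s f)
      = -(inner ℝ (vec A s) f • vec A s) := by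
  refine ext_inner_right ℝ fun g => ?_
  rw [inner_add_left, hA.inner_opA_comm s _ g, hA.deriv.inner_opA_comm s _ g, inner_neg_left,
    real_inner_smul_left, ← hA.inner_opA_add, add_comm]

theorem res_sub (s : ℝ) (h : IsUnit (1 - opK A s)) (f : L2) :
    res A s f - opA A s (opA A s (res A s f)) = f := by
  have := congrArg (fun T : L2 →L[ℝ] L2 => T f) (Ring.mul_inverse_cancel _ h)
  simpa [opK, sq, res] using this

theorem res_sub_apply (s : ℝ) (h : IsUnit (1 - opK A s)) (f : L2) :
    res A s (f - opA A s (opA A s f)) = f := by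
  have := congrArg (fun T : L2 →L[ℝ] L2 => T f) (Ring.inverse_mul_cancel _ h)
  simpa [opK, sq, res] using this

theorem SmoothDecay.inner_res_comm (hA : SmoothDecay A) (s : ℝ) (h : IsUnit (1 - opK A s))
    (f g : L2) : inner ℝ (res A s f) g = inner ℝ f (res A s g) := by
  conv_lhs => rw [← res_sub s h g]
  conv_rhs => rw [← res_sub s h f]
  rw [inner_sub_left, inner_sub_right, hA.inner_opA_comm, hA.inner_opA_comm]

theorem SmoothDecay.hasDerivAt_res (hA : SmoothDecay A) (s : ℝ) (h : IsUnit (1 - opK A s)) :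
    HasDerivAt (res A) (res A s * (opA (deriv A) s * opA A s + opA A s * opA (deriv A) s)
      * res A s) s := by
  obtain ⟨U, hU⟩ := h
  have h1 : HasDerivAt (fun t => 1 - opK A t)
      (-(opA (deriv A) s * opA A s + opA A s * opA (deriv A) s)) s := by
    simpa [opK, sq] using ((hA.hasDerivAt_opA s).mul (hA.hasDerivAt_opA s)).const_sub 1
  have h2 := hasFDerivAt_ringInverse (𝕜 := ℝ) U
  rw [hU] at h2
  have h3 := h2.comp_hasDerivAt s h1
  refine h3.congr_deriv ?_
  rw [res, ← hU, Ring.inverse_unit]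
  rw [neg_apply, ContinuousLinearMap.mulLeftRight_apply, mul_neg, neg_mul, neg_neg]

/-- The derivative of the resolvent is `-R|a⟩⟨a|R`, since the derivative of `K_s` is the rank-one
operator `-|a⟩⟨a|`. -/
theorem SmoothDecay.hasDerivAt_res_apply (hA : SmoothDecay A) (s : ℝ) (h : IsUnit (1 - opK A s))
    {f : ℝ → L2} {f' : L2} (hf : HasDerivAt f f' s) :
    HasDerivAt (fun t => res A t (f t))
      (res A s f' - inner ℝ (vec A s) (res A s (f s)) • res A s (vec A s)) s := by
  refine ((hA.hasDerivAt_res s h).clm_apply hf).congr_deriv ?_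
  have := hA.opA_opA_deriv_add s (res A s (f s))
  simp only [mul_apply_eq_comp, add_apply]
  rw [add_comm (opA (deriv A) s _), this, map_neg, map_smul]
  abel

theorem SmoothDecay.hasDerivAt_u (hA : SmoothDecay A) (s : ℝ) (h : IsUnit (1 - opK A s)) (p : ℕ) :
    HasDerivAt (u A p) (-(q A 0 s * q A p s)) s := by
  have hp := hA.iteratedDeriv p
  have h1 := (hA.hasDerivAt_vec s).inner ℝ (hA.hasDerivAt_res_apply s h (hp.hasDerivAt_vec s))
  have e : u A p = fun t => inner ℝ (vec A t) (res A t (vec (iteratedDeriv p A) t)) := by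
    ext t; simp [u, vecA, vec]
  rw [e]
  refine h1.congr_deriv ?_
  have key := hierarchy_identity (hA.inner_opA_comm s) (hA.deriv.inner_opA_comm s)
    (hA.inner_res_comm s h) (res_sub s h) (res_sub_apply s h) (hA.opA_opA_deriv_add s)
    (hA.opA_vec_add hp s) (hA.opA_vec_add hA s) (hA.inner_vec_add hp s s)
  have q0 : q A 0 s = A s + inner ℝ (vec A s) (res A s (opA A s (vec A s))) := by
    simp [q, vecA, vec]
  have qp : q A p s = iteratedDeriv p A s
      + inner ℝ (vec (iteratedDeriv p A) s) (res A s (opA A s (vec A s))) := by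
    simp [q, vecA, vec]
  rw [q0, qp, ← key, inner_sub_right, real_inner_smul_right]
  ring

theorem SmoothDecay.hasDerivAt_q (hA : SmoothDecay A) (s : ℝ) (h : IsUnit (1 - opK A s)) (p : ℕ) :
    HasDerivAt (q A p) (q A (p + 1) s - q A 0 s * u A p s) s := by
  have hp := hA.iteratedDeriv p
  have h1 := (hp.hasDerivAt s).add ((hp.hasDerivAt_vec s).inner ℝ (hA.hasDerivAt_res_apply s h
    ((hA.hasDerivAt_opA s).clm_apply (hA.hasDerivAt_vec s))))
  have e : q A p = fun t => iteratedDeriv p A t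
      + inner ℝ (vec (iteratedDeriv p A) t) (res A t (opA A t (vec A t))) := by
    ext t; simp [q, vecA, vec]
  have e1 : q A (p + 1) s = deriv (iteratedDeriv p A) s
      + inner ℝ (vec (deriv (iteratedDeriv p A)) s) (res A s (opA A s (vec A s))) := by
    simp [q, vecA, vec, iteratedDeriv_succ]
  have e0 : q A 0 s = A s + inner ℝ (vec A s) (res A s (opA A s (vec A s))) := by
    simp [q, vecA, vec]
  have eu : u A p s = inner ℝ (vec (iteratedDeriv p A) s) (res A s (vec A s)) := by
    rw [← hA.inner_res_comm s h, real_inner_comm]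
    simp [u, vecA, vec]
  rw [e1, e0, eu, e]
  refine h1.congr_deriv ?_
  -- The derivative of `A_s a_0` collapses to `-A(s) a_0`, which combines with the rank-one
  -- resolvent term into the factor `q_0`.
  rw [add_comm (opA (deriv A) s _), hA.opA_vec_add hA s, inner_sub_right, real_inner_smul_right,
    map_neg, map_smul, inner_neg_right, real_inner_smul_right]
  ring

/-! ### Compactness of `A_s`. -/

/-- An `L²` family of vectors `v x` of a Hilbert space defines a Hilbert–Schmidt, hence compact,
operator `f ↦ (x ↦ ⟨f, v x⟩)`. -/
theorem isCompactOperator_inner_compLp {α H : Type*} [MeasurableSpace α] {μ : Measure α}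
    [NormedAddCommGroup H] [InnerProductSpace ℝ H] (v : Lp H 2 μ) :
    IsCompactOperator (((innerSL ℝ : H →L[ℝ] H →L[ℝ] ℝ).compLpL₂ 2 μ).flip v) := by
  set Φ := ((innerSL ℝ : H →L[ℝ] H →L[ℝ] ℝ).compLpL₂ 2 μ).flip with hΦ
  -- Indicator families give rank-one operators, sums preserve compactness, and compact operators
  -- are norm-closed while `Φ` is continuous.
  refine Lp.induction (by simp) (motive := fun v => IsCompactOperator (Φ v)) ?_ ?_ ?_ v
  · intro c S hS hμS
    have e : Φ (Lp.simpleFunc.indicatorConst 2 hS hμS.ne c)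
        = (innerSL ℝ c).smulRight (indicatorConstLp 2 hS hμS.ne (1 : ℝ)) := by
      ext1 f
      apply Lp.ext
      have e2 : Φ (Lp.simpleFunc.indicatorConst 2 hS hμS.ne c) f
        = (innerSL ℝ f).compLp (indicatorConstLp 2 hS hμS.ne c) := by
          rw [hΦ, ContinuousLinearMap.flip_apply, ContinuousLinearMap.compLpL₂_apply_apply,
            Lp.simpleFunc.coe_indicatorConst]
      rw [e2, ContinuousLinearMap.smulRight_apply]
      filter_upwards [(innerSL ℝ f).coeFn_compLp (indicatorConstLp 2 hS hμS.ne c),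
        Lp.coeFn_smul (innerSL ℝ c f) (indicatorConstLp 2 hS hμS.ne (1 : ℝ)),
        indicatorConstLp_coeFn (p := 2) (hs := hS) (hμs := hμS.ne) (c := c),
        indicatorConstLp_coeFn (p := 2) (hs := hS) (hμs := hμS.ne) (c := (1 : ℝ))]
        with x h1 h2 h3 h4
      rw [h1, h2, Pi.smul_apply, h3, h4]
      by_cases hx : x ∈ S <;> simp [hx, real_inner_comm]
    rw [e]
    exact (isCompactOperator_of_locallyCompactSpace_dom (innerSL ℝ c)).clm_comp
      (ContinuousLinearMap.toSpanSingleton ℝ (indicatorConstLp 2 hS hμS.ne (1 : ℝ)))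
  · intro f g hf hg _ h1 h2
    rw [map_add]
    exact h1.add h2
  · exact isClosed_setOfPred_isCompactOperator.preimage Φ.continuous

theorem SmoothDecay.continuous_vec (hA : SmoothDecay A) : Continuous (vec A) :=
  continuous_iff_continuousAt.2 fun s => (hA.hasDerivAt_vec s).continuousAt

theorem SmoothDecay.memLp_vec (hA : SmoothDecay A) (s : ℝ) :
    MemLp (fun x => vec A (x + s)) 2 halfLine := by
  obtain ⟨c, C, hc0, hC0, hC⟩ := exists_exp_bound hA.continuous hA.expDecay s
  refine (memLp_exp hc0).of_le_mul (c := C * Real.exp (-c * s) * ‖(memLp_exp hc0).toLp _‖) ?_ ?_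
  · have := hA.continuous_vec
    exact Continuous.aestronglyMeasurable (by fun_prop)
  · filter_upwards [ae_restrict_mem measurableSet_Ioi] with x hx
    have hx : 0 < x := hx
    rw [Real.norm_of_nonneg (Real.exp_pos _).le]
    refine (norm_le_of_exp_bound hc0 (M := C * Real.exp (-c * (x + s))) ?_).trans_eq ?_
    · filter_upwards [coeFn_vec hA.continuous hA.expDecay (x + s),
        ae_restrict_mem measurableSet_Ioi] with y e hy
      have hy : 0 < y := hy
      rw [e, mul_assoc, ← Real.exp_add]
      refine (hC _ (by linarith)).trans_eq ?_
      ring_nf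
    · rw [mul_add, Real.exp_add]; ring

theorem SmoothDecay.isCompactOperator_opA (hA : SmoothDecay A) (s : ℝ) :
    IsCompactOperator (opA A s) := by
  suffices e : opA A s = ((innerSL ℝ : L2 →L[ℝ] L2 →L[ℝ] ℝ).compLpL₂ 2 halfLine).flip
      ((hA.memLp_vec s).toLp _) by
    rw [e]; exact isCompactOperator_inner_compLp _
  ext1 f
  apply Lp.ext
  rw [ContinuousLinearMap.flip_apply, ContinuousLinearMap.compLpL₂_apply_apply]
  filter_upwards [hA.opA_apply s f, (hA.memLp_vec s).coeFn_toLp,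
    (innerSL ℝ f).coeFn_compLp ((hA.memLp_vec s).toLp _)] with x h1 h2 h3
  rw [h1, h3, h2, innerSL_apply_apply, real_inner_comm]

/-! ### Orthogonality makes every `A_t` a contraction. -/

/-- The subspace of `L²(ℝ₊)` of smooth functions with compact support in `(0, ∞)`. -/
def testFunctions : Submodule ℝ L2 where
  carrier := {f | ∃ φ : ℝ → ℝ, ContDiff ℝ ∞ φ ∧ HasCompactSupport φ ∧
    tsupport φ ⊆ Set.Ioi 0 ∧ f =ᵐ[halfLine] φ}
  zero_mem' := ⟨0, contDiff_const, HasCompactSupport.zero, by simp, Lp.coeFn_zero _ _ _⟩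
  add_mem' := by
    rintro f g ⟨φ, h1, h2, h3, h4⟩ ⟨ψ, k1, k2, k3, k4⟩
    exact ⟨φ + ψ, h1.add k1, h2.add k2, (tsupport_add φ ψ).trans (Set.union_subset h3 k3),
      (Lp.coeFn_add f g).trans (h4.add k4)⟩
  smul_mem' := by
    rintro c f ⟨φ, h1, h2, h3, h4⟩
    exact ⟨c • φ, h1.const_smul c, h2.smul_left, (tsupport_smul_subset_right (fun _ => c) φ).trans h3,
      (Lp.coeFn_smul c f).trans (h4.const_smul c)⟩

theorem dense_testFunctions : Dense (testFunctions : Set L2) := by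
  rw [Submodule.dense_iff_topologicalClosure_eq_top, Submodule.topologicalClosure_eq_top_iff,
    Submodule.eq_bot_iff]
  intro f hf
  rw [Submodule.mem_orthogonal] at hf
  have hloc : LocallyIntegrableOn f (Set.Ioi (0 : ℝ)) volume :=
    locallyIntegrableOn_of_locallyIntegrable_restrict
      ((Lp.memLp f).locallyIntegrable (by norm_num))
  have h := isOpen_Ioi.ae_eq_zero_of_integral_contDiff_smul_eq_zero hloc fun φ h1 h2 h3 => ?_
  · apply Lp.ext
    filter_upwards [(ae_restrict_iff' measurableSet_Ioi).2 h, Lp.coeFn_zero ℝ 2 halfLine]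
      with x hx h0
    rw [hx, h0, Pi.zero_apply]
  · have hm : MemLp φ 2 halfLine := h1.continuous.memLp_of_hasCompactSupport h2
    have := hf (hm.toLp φ) ⟨φ, h1, h2, h3, hm.coeFn_toLp⟩
    rw [inner_eq_integral] at this
    rw [← this, ← setIntegral_eq_integral_of_forall_compl_eq_zero (s := Set.Ioi (0 : ℝ))]
    · refine integral_congr_ae ?_
      filter_upwards [hm.coeFn_toLp] with x hx
      rw [hx, smul_eq_mul]
    · intro x hx
      rw [image_eq_zero_of_notMem_tsupport fun h => hx (h3 h), zero_smul]

/-- For a test function `φ` supported in `(0, ∞)`, orthogonality says that `H(r) = ∫ A(x + r) φ(x)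
dx` has the same norm in `L²(ℝ)` as `φ`, and `A_t φ` is a translate of `H` cut to the half-line.
Density gives the rest. -/
theorem SmoothDecay.norm_opA_le_of_orthogonality (hA : SmoothDecay A) (ho : Orthogonality A)
    (t : ℝ) (f : L2) : ‖opA A t f‖ ≤ ‖f‖ := by
  refine dense_testFunctions.induction (P := fun f => ‖opA A t f‖ ≤ ‖f‖) ?_
    (isClosed_le (by fun_prop) (by fun_prop)) f
  rintro f ⟨φ, h1, h2, h3, h4⟩
  obtain ⟨hint, heq⟩ := ho φ φ h1 h2 h1 h2
  set H : ℝ → ℝ := fun r => ∫ x, A (x + r) * φ x with hH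
  have hint' : Integrable (fun r => H r * H r) := by
    refine hint.congr (Eventually.of_forall fun r => ?_)
    simp [hH, add_comm]
  have heq' : ∫ r, H r * H r = ∫ x, φ x * φ x := by
    rw [← heq]
    refine integral_congr_ae (Eventually.of_forall fun r => ?_)
    simp [hH, add_comm]
  have hop : opA A t f =ᵐ[halfLine] fun r => H (r + t) := by
    filter_upwards [hA.opA_apply t f] with r hr
    rw [hr, inner_vec hA.continuous hA.expDecay, hH]
    simp only
    rw [← setIntegral_eq_integral_of_forall_compl_eq_zero (s := Set.Ioi (0 : ℝ))
      (f := fun x => A (x + (r + t)) * φ x)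
      (fun x hx => by rw [image_eq_zero_of_notMem_tsupport fun h => hx (h3 h), mul_zero])]
    refine integral_congr_ae ?_
    filter_upwards [h4] with x hx
    rw [hx]
  have hf : inner ℝ f f = ∫ x, φ x * φ x := by
    rw [inner_eq_integral, ← setIntegral_eq_integral_of_forall_compl_eq_zero
      (s := Set.Ioi (0 : ℝ)) (f := fun x => φ x * φ x)
      (fun x hx => by rw [image_eq_zero_of_notMem_tsupport fun h => hx (h3 h), mul_zero])]
    refine integral_congr_ae ?_
    filter_upwards [h4] with x hx
    rw [hx]
  have hT : inner ℝ (opA A t f) (opA A t f) ≤ inner ℝ f f := by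
    calc inner ℝ (opA A t f) (opA A t f) = ∫ r, H (r + t) * H (r + t) ∂halfLine := by
          rw [inner_eq_integral]
          refine integral_congr_ae ?_
          filter_upwards [hop] with r hr
          rw [hr]
      _ ≤ ∫ r, H (r + t) * H (r + t) :=
          setIntegral_le_integral (hint'.comp_add_right t)
            (Eventually.of_forall fun r => mul_self_nonneg _)
      _ = inner ℝ f f := by
          rw [hf, ← heq', integral_add_right_eq_self (fun r => H r * H r)]
  rw [real_inner_self_eq_norm_sq, real_inner_self_eq_norm_sq] at hT
  exact le_of_sq_le_sq hT (norm_nonneg _)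

/-! ### Analytic continuation of `r ↦ ⟨vec A r, f⟩`. -/

theorem exists_strip_bound {F : ℂ → ℂ} {ε c C : ℝ} (hε : 0 < ε)
    (hF : DifferentiableOn ℂ F {z | |z.im| < ε})
    (hC : ∀ z : ℂ, |z.im| < ε → 0 ≤ z.re → ‖F z‖ ≤ C * Real.exp (-c * z.re)) (a : ℝ) :
    ∃ M : ℝ, 0 ≤ M ∧ ∀ z : ℂ, |z.im| ≤ ε / 2 → a ≤ z.re → ‖F z‖ ≤ M * Real.exp (-c * z.re) := by
  have hK : IsCompact (Set.Icc a 0 ×ℂ Set.Icc (-(ε / 2)) (ε / 2)) :=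
    isCompact_Icc.reProdIm isCompact_Icc
  have hcont : ContinuousOn (fun z : ℂ => ‖F z‖ * Real.exp (c * z.re))
      (Set.Icc a 0 ×ℂ Set.Icc (-(ε / 2)) (ε / 2)) := by
    refine ContinuousOn.mul (hF.continuousOn.norm.mono fun z hz => ?_) (by fun_prop)
    have := abs_le.2 hz.2
    exact lt_of_le_of_lt this (by linarith)
  obtain ⟨M, hM⟩ := hK.exists_bound_of_continuousOn hcont
  refine ⟨max 0 (max M C), le_max_left _ _, fun z hz ha => ?_⟩
  rcases le_or_gt z.re 0 with h | h
  · have := hM z ⟨⟨ha, h⟩, abs_le.1 hz⟩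
    rw [Real.norm_of_nonneg (by positivity)] at this
    have h2 : ‖F z‖ ≤ M * Real.exp (-c * z.re) := by
      have := mul_le_mul_of_nonneg_right this (Real.exp_pos (-c * z.re)).le
      rwa [mul_assoc, ← Real.exp_add, show c * z.re + -c * z.re = 0 by ring, Real.exp_zero,
        mul_one] at this
    exact h2.trans (by gcongr; exact (le_max_left _ _).trans (le_max_right _ _))
  · refine (hC z (lt_of_le_of_lt hz (by linarith)) h.le).trans ?_
    gcongr
    exact (le_max_right _ _).trans (le_max_right _ _)

/-- Differentiation under the integral sign, with `deriv F` dominated by Cauchy's estimate. Discs of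
radius `ε / 4` around points with `|Im z| < ε / 4` stay in `|Im z| ≤ ε / 2`, where `F` is bounded
exponentially. -/
theorem differentiableAt_integral_strip {F : ℂ → ℂ} {ε c C : ℝ} (hε : 0 < ε) (hc : 0 < c)
    (hF : DifferentiableOn ℂ F {z | |z.im| < ε})
    (hC : ∀ z : ℂ, |z.im| < ε → 0 ≤ z.re → ‖F z‖ ≤ C * Real.exp (-c * z.re)) (f : L2)
    {z₀ : ℂ} (hz₀ : |z₀.im| < ε / 4) :
    DifferentiableAt ℂ (fun z : ℂ => ∫ x : ℝ, F (x + z) * (f x : ℂ) ∂halfLine) z₀ := by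
  have hopen : IsOpen {z : ℂ | |z.im| < ε} :=
    isOpen_lt (by fun_prop) continuous_const
  -- The left end allows for moving `z` by `1` to the left of `z₀` and for the radius `ε / 4` of the
  -- Cauchy discs.
  obtain ⟨M, hM0, hM⟩ := exists_strip_bound hε hF hC (z₀.re - 1 - ε / 4)
  have hfm : AEStronglyMeasurable (fun x => (f x : ℂ)) halfLine :=
    Complex.continuous_ofReal.comp_aestronglyMeasurable (Lp.aestronglyMeasurable f)
  have hmeas : ∀ G : ℂ → ℂ, ContinuousOn G {z | |z.im| < ε} → ∀ z : ℂ, |z.im| < ε →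
      AEStronglyMeasurable (fun x : ℝ => G (x + z) * (f x : ℂ)) halfLine := by
    intro G hG z hz
    refine AEStronglyMeasurable.mul (Continuous.aestronglyMeasurable ?_) hfm
    exact hG.comp_continuous (by fun_prop) fun x => by simpa using hz
  have hexp : Integrable (fun x => Real.exp (-c * x) * |f x|) halfLine :=
    (memLp_exp hc).integrable_mul (Lp.memLp f).abs
  set S : Set ℂ := {z | |z.im| < ε / 4} ∩ {z | z₀.re - 1 < z.re} with hS
  have hSopen : IsOpen S := (isOpen_lt (by fun_prop) continuous_const).inter
    (isOpen_lt continuous_const (by fun_prop))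
  have hz₀S : z₀ ∈ S := ⟨hz₀, by simp⟩
  refine (hasDerivAt_integral_of_dominated_loc_of_deriv_le (hSopen.mem_nhds hz₀S)
    (F' := fun z x => deriv F (x + z) * (f x : ℂ))
    (bound := fun x => M * Real.exp (-c * (z₀.re - 1 - ε / 4)) / (ε / 4)
      * (Real.exp (-c * x) * |f x|)) ?_ ?_ ?_ ?_ (hexp.const_mul _) ?_).2.differentiableAt
  · filter_upwards [hSopen.mem_nhds hz₀S] with z hz
    exact hmeas F hF.continuousOn z (lt_trans hz.1 (by linarith))
  · refine (hexp.const_mul (M * Real.exp (-c * z₀.re))).mono'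
      (hmeas F hF.continuousOn z₀ (by linarith)) ?_
    filter_upwards [ae_restrict_mem measurableSet_Ioi] with x hx
    have hx : 0 < x := hx
    have := hM (x + z₀) (by simp; linarith) (by simp; linarith)
    rw [norm_mul, Complex.norm_real, Real.norm_eq_abs, ← mul_assoc]
    gcongr
    refine this.trans_eq ?_
    rw [mul_assoc, ← Real.exp_add]
    simp only [Complex.add_re, Complex.ofReal_re]
    ring_nf
  · exact hmeas (deriv F) (hF.deriv hopen).continuousOn z₀ (by linarith)
  · filter_upwards [ae_restrict_mem measurableSet_Ioi] with x hx z hz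
    have hx : 0 < x := hx
    have hz1 : |z.im| < ε / 4 := hz.1
    have hz2 : z₀.re - 1 < z.re := hz.2
    rw [norm_mul, Complex.norm_real, Real.norm_eq_abs, ← mul_assoc]
    gcongr
    have hcl : ∀ w ∈ Metric.closedBall ((x : ℂ) + z) (ε / 4),
        |w.im| ≤ ε / 2 ∧ x + (z₀.re - 1 - ε / 4) ≤ w.re := by
      intro w hw
      rw [mem_closedBall_iff_norm] at hw
      have h1 := (Complex.abs_im_le_norm _).trans hw
      have h2 := (Complex.abs_re_le_norm _).trans hw
      simp only [Complex.sub_im, Complex.add_im, Complex.ofReal_im, zero_add, Complex.sub_re,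
        Complex.add_re, Complex.ofReal_re] at h1 h2
      rw [abs_le] at h1 h2
      rw [abs_lt] at hz1
      exact ⟨abs_le.2 ⟨by linarith, by linarith⟩, by linarith⟩
    have := Complex.norm_deriv_le_of_forall_mem_sphere_norm_le (c := (x : ℂ) + z) (R := ε / 4)
      (C := M * Real.exp (-c * (x + (z₀.re - 1 - ε / 4)))) (by positivity)
      (DifferentiableOn.diffContOnCl_ball (U := {z | |z.im| < ε}) hF fun w hw =>
        lt_of_le_of_lt (hcl w hw).1 (by linarith))
      (fun w hw => by
        obtain ⟨h1, h2⟩ := hcl w (Metric.sphere_subset_closedBall hw)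
        refine (hM w h1 (by linarith)).trans ?_
        have : -c * w.re ≤ -c * (x + (z₀.re - 1 - ε / 4)) :=
          mul_le_mul_of_nonpos_left h2 (by linarith)
        gcongr)
    refine this.trans_eq ?_
    rw [mul_add (-c), Real.exp_add]
    ring
  · refine Eventually.of_forall fun x z hz => HasDerivAt.mul_const ?_ _
    have hz1 : |z.im| < ε / 4 := hz.1
    have hd : DifferentiableAt ℂ F (x + z) :=
      hF.differentiableAt (hopen.mem_nhds (by simp; linarith))
    simpa using hd.hasDerivAt.comp_const_add (x : ℂ) z

/-- The function extends holomorphically to a convex strip containing the real line, so the identity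
theorem applies from any interior point of the interval. -/
theorem SmoothDecay.inner_vec_eq_zero (hA : SmoothDecay A) (ha : AnalyticInStrip A) {f : L2}
    {a b : ℝ} (hab : a < b) (h : ∀ r ∈ Set.Ioo a b, inner ℝ (vec A r) f = 0) (r : ℝ) :
    inner ℝ (vec A r) f = 0 := by
  obtain ⟨F, ε, c, C, hε, hc, hF, hFA, hC⟩ := ha
  set G : ℂ → ℂ := fun z => ∫ x : ℝ, F (x + z) * (f x : ℂ) ∂halfLine with hG
  have hGr : ∀ r : ℝ, G r = ((inner ℝ (vec A r) f : ℝ) : ℂ) := by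
    intro r
    rw [inner_vec hA.continuous hA.expDecay, ← integral_complex_ofReal]
    refine integral_congr_ae (Eventually.of_forall fun x => ?_)
    simp only
    rw [← Complex.ofReal_add, hFA, Complex.ofReal_mul]
  have hU : IsOpen {z : ℂ | |z.im| < ε / 4} := isOpen_lt (by fun_prop) continuous_const
  have han : AnalyticOnNhd ℂ G {z : ℂ | |z.im| < ε / 4} :=
    DifferentiableOn.analyticOnNhd (fun z hz =>
      (differentiableAt_integral_strip hε hc hF hC f hz).differentiableWithinAt) hU
  have hconv : Convex ℝ {z : ℂ | |z.im| < ε / 4} := by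
    have : {z : ℂ | |z.im| < ε / 4} = Complex.imCLM ⁻¹' Set.Ioo (-(ε / 4)) (ε / 4) := by
      ext z; simp [abs_lt]
    rw [this]
    exact (convex_Ioo _ _).linear_preimage Complex.imCLM.toLinearMap
  have hmem : ∀ r : ℝ, (r : ℂ) ∈ {z : ℂ | |z.im| < ε / 4} := fun r => by
    simpa using hε
  obtain ⟨m, hm⟩ := Set.nonempty_Ioo.2 hab
  have hfreq : ∃ᶠ z in nhdsWithin (m : ℂ) {(m : ℂ)}ᶜ, G z = 0 := by
    have ht : Tendsto (fun r : ℝ => (r : ℂ)) (nhdsWithin m {m}ᶜ)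
        (nhdsWithin (m : ℂ) {(m : ℂ)}ᶜ) := by
      refine tendsto_nhdsWithin_iff.2 ⟨Complex.continuous_ofReal.continuousAt.mono_left
        nhdsWithin_le_nhds, ?_⟩
      filter_upwards [self_mem_nhdsWithin] with r hr
      simpa using hr
    refine ht.frequently (Eventually.frequently ?_)
    filter_upwards [nhdsWithin_le_nhds (Ioo_mem_nhds hm.1 hm.2)] with r hr
    rw [hGr, h r hr, Complex.ofReal_zero]
  have := han.eqOn_zero_of_preconnected_of_frequently_eq_zero hconv.isPreconnected (hmem m) hfreq
    (hmem r)
  rw [hGr, Pi.zero_apply] at this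
  exact_mod_cast this

/-! ### Invertibility of `I - K_s`. -/

theorem SmoothDecay.isUnit_one_sub_opK (hA : SmoothDecay A) (ho : Orthogonality A)
    (ha : AnalyticInStrip A) (s : ℝ) : IsUnit (1 - opK A s) := by
  have hcomp : IsCompactOperator (opK A s) := by
    rw [opK, sq]
    exact (hA.isCompactOperator_opA s).comp_clm (opA A s)
  rcases hcomp.hasEigenvalue_or_mem_resolventSet (one_ne_zero (α := ℝ)) with h | h
  · exfalso
    obtain ⟨f, hf⟩ := h.exists_hasEigenvector
    have hK : opA A s (opA A s f) = f := by simpa [opK, sq] using hf.apply_eq_smul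
    apply hf.2
    have hnorm : inner ℝ (opA A s f) (opA A s f) = inner ℝ f f := by
      rw [hA.inner_opA_comm, hK]
    -- Only `s - 1 < s` matters: a strictly smaller parameter sees an additional interval of the
    -- same function.
    have hle : inner ℝ (opA A (s - 1) f) (opA A (s - 1) f) ≤ inner ℝ f f := by
      rw [real_inner_self_eq_norm_sq, real_inner_self_eq_norm_sq]
      gcongr
      exact hA.norm_opA_le_of_orthogonality ho (s - 1) f
    rw [← hnorm, hA.inner_opA_opA hA, hA.inner_opA_opA hA] at hle
    set ψ : ℝ → ℝ := fun x => inner ℝ (vec A (x + (s - 1))) f with hψ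
    have hψc : Continuous ψ := by
      have := hA.continuous_vec
      fun_prop
    have hψi : IntegrableOn (fun x => ψ x * ψ x) (Set.Ioi 0) :=
      (hA.memLp_inner_vec (s - 1) f).integrable_mul (hA.memLp_inner_vec (s - 1) f)
    have hshift : ∫ x in Set.Ioi (0 : ℝ), inner ℝ (vec A (x + s)) f * inner ℝ (vec A (x + s)) f
        = ∫ x in Set.Ioi (1 : ℝ), ψ x * ψ x := by
      have := (measurePreserving_add_right volume (1 : ℝ)).setIntegral_preimage_emb
        (measurableEmbedding_addRight 1) (fun x => ψ x * ψ x) (Set.Ioi 1)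
      rw [← this, Set.preimage_add_const_Ioi, sub_self]
      simp only [hψ, show ∀ x : ℝ, x + 1 + (s - 1) = x + s from fun x => by ring]
    change ∫ x in Set.Ioi (0 : ℝ), ψ x * ψ x ≤ _ at hle
    rw [hshift, ← Set.Ioc_union_Ioi_eq_Ioi (zero_le_one (α := ℝ)),
      setIntegral_union (Set.Ioc_disjoint_Ioi le_rfl) measurableSet_Ioi
        (hψi.mono_set Set.Ioc_subset_Ioi_self)
        (hψi.mono_set (Set.Ioi_subset_Ioi zero_le_one))] at hle
    -- The integral over `(1, ∞)` is already all of `‖f‖²`, so contractivity leaves nothing for `(0,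
    -- 1]`.
    have hzero : ∫ x in Set.Ioc (0 : ℝ) 1, ψ x * ψ x = 0 :=
      le_antisymm (by linarith) (integral_nonneg fun x => mul_self_nonneg _)
    rw [setIntegral_eq_zero_iff_of_nonneg_ae (Eventually.of_forall fun x => mul_self_nonneg _)
      (hψi.mono_set Set.Ioc_subset_Ioi_self)] at hzero
    have hψ0 : Set.EqOn ψ 0 (Set.Ioo 0 1) := by
      refine Measure.eqOn_open_of_ae_eq (μ := volume) ?_ isOpen_Ioo hψc.continuousOn
        continuousOn_const
      filter_upwards [ae_restrict_of_ae_restrict_of_subset Set.Ioo_subset_Ioc_self hzero] with x hx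
      exact mul_self_eq_zero.1 hx
    have hall := hA.inner_vec_eq_zero ha (f := f) (a := s - 1) (b := s) (by linarith)
      fun r hr => by
        have := hψ0 (x := r - (s - 1)) ⟨by linarith [hr.1], by linarith [hr.2]⟩
        simpa [hψ] using this
    have hA0 : opA A s f = 0 := by
      apply Lp.ext
      filter_upwards [hA.opA_apply s f, Lp.coeFn_zero ℝ 2 halfLine] with x h1 h2
      rw [h1, h2, hall, Pi.zero_apply]
    rw [← hK, hA0, map_zero]
  · simpa [spectrum.mem_resolventSet_iff] using h

end

end HankelHierarchy

theorem mainTheorem1 (A : ℝ → ℝ) (hA : ContDiff ℝ ∞ A)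
    (hdecay : ∀ p : ℕ, HankelHierarchy.ExpDecay (iteratedDeriv p A)) :
    -- In the setting of an orthogonal analytic `A`, the resolvent exists for every `s`.
    (HankelHierarchy.Orthogonality A → HankelHierarchy.AnalyticInStrip A →
      ∀ s : ℝ, IsUnit (1 - HankelHierarchy.opK A s)) ∧
    -- The hierarchy holds at every `s` at which `I - K_s` is invertible.
    ∀ s : ℝ, IsUnit (1 - HankelHierarchy.opK A s) → ∀ p : ℕ,
      HasDerivAt (HankelHierarchy.q A p)
        (HankelHierarchy.q A (p + 1) s - HankelHierarchy.q A 0 s * HankelHierarchy.u A p s) s ∧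
      HasDerivAt (HankelHierarchy.u A p)
        (-(HankelHierarchy.q A 0 s * HankelHierarchy.q A p s)) s := by
  have h : HankelHierarchy.SmoothDecay A := ⟨hA, hdecay⟩
  exact ⟨h.isUnit_one_sub_opK, fun s hs p => ⟨h.hasDerivAt_q s hs p, h.hasDerivAt_u s hs p⟩⟩
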